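/- Let $m>0$. For $x\in\mathbb R^3\setminus\{0\}$ and $t>0$ put $$g(x)=\frac{e^{-m|x|}}{4\pi|x|},\qquad \gamma(x,t)=\frac{\theta(t-|x|)}{4\pi|x|}-\frac{m}{4\pi}\int_0^t\frac{\theta(s-|x|)\,J_1\big(m\sqrt{s^2-|x|^2}\big)}{\sqrt{s^2-|x|^2}}\,ds,$$ where $\theta$ is the Heaviside function and $J_1$ is the Bessel function of the first kind of order $1$. For $\varepsilon\ge 0$ let $K_m^\varepsilon=(-\Delta+m^2)^{-\varepsilon}$ be the operator on $L^2(\mathbb R^3)$ of multiplication by $(|\xi|^2+m^2)^{-\varepsilon}$ in the Fourier variable $\xi$, that is, formally, $$(K_m^\varepsilon\psi)(x)=\frac1{(2\pi)^3}\int_{\mathbb R^3}e^{-i\xi\cdot x}\,\frac{\hat\psi(\xi)}{(|\xi|^2+m^2)^{\varepsilon}}\,d\xi,\qquad \hat\psi(\xi)=\int_{\mathbb R^3}e^{i\xi\cdot x}\psi(x)\,dx.$$ Then for every $t>0$ the function $g-\gamma(\cdot,t)$ belongs to $L^2(\mathbb R^3)$; for every $\varepsilon>0$ the limit $\lim_{x\to0}K_m^\varepsilon\big(g-\gamma(\cdot,t)\big)(x)$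 exists (as an essential limit, elements of $L^2$ being defined up to null sets); and the limits in $$\mu(t):=\lim_{\varepsilon\to0+}\,\lim_{x\to0}K_m^\varepsilon\big(g-\gamma(\cdot,t)\big)(x)=\lim_{x\to0}\big(g(x)-\gamma(x,t)\big)=-\frac m{4\pi}+\frac m{4\pi}\int_0^t\frac{J_1(ms)}s\,ds$$ exist and the equalities hold, where $s\mapsto J_1(ms)/s$ is integrable on $(0,t)$. The function $\mu$ is continuous on $(0,\infty)$, and $\lim_{t\to0+}\mu(t)=-\dfrac m{4\pi}$. -/

import Mathlib

open MeasureTheory Filter Topology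
open scoped FourierTransform ENNReal Nat

noncomputable section

namespace DiracPoint

/-- Physical space `ℝ³` with the Euclidean norm and Lebesgue measure. -/
abbrev Space : Type := EuclideanSpace ℝ (Fin 3)

/-- The Bessel function of the first kind of integer order `n ≥ 0`, on the real line:
`J_n(z) = ∑ₖ (-1)ᵏ / (k! (k+n)!) (z/2)^(2k+n)`. -/
def besselJ (n : ℕ) (z : ℝ) : ℝ :=
  ∑' k : ℕ, (-1 : ℝ) ^ k / ((k ! : ℝ) * ((k + n)! : ℝ)) * (z / 2) ^ (2 * k + n)

/-- The Heaviside function. -/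
def heaviside (r : ℝ) : ℝ := if 0 ≤ r then 1 else 0

/-- The Green function `e^{-m|x|} / (4π|x|)` of `-Δ + m²` in `ℝ³`. -/
def green (m : ℝ) (x : Space) : ℝ :=
  Real.exp (-m * ‖x‖) / (4 * Real.pi * ‖x‖)

/-- The solution `γ(x,t)` of the Klein–Gordon equation with source `δ(x)` and zero initial data,
given by its explicit formula. -/
def kleinGordonGamma (m : ℝ) (x : Space) (t : ℝ) : ℝ :=
  heaviside (t - ‖x‖) / (4 * Real.pi * ‖x‖)
    - m / (4 * Real.pi) *
      ∫ s in (0 : ℝ)..t,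
        heaviside (s - ‖x‖) * besselJ 1 (m * √(s ^ 2 - ‖x‖ ^ 2)) / √(s ^ 2 - ‖x‖ ^ 2)

/-- The symbol `(|ξ|² + m²)^{-ε}` of `(-Δ + m²)^{-ε}`. Mathlib's Fourier transform has the kernel
`e^{-2πi⟨x, k⟩}`, so the frequency variable `ξ` is `2πk`. -/
def smoothingSymbol (m ε : ℝ) (k : Space) : ℝ :=
  ((2 * Real.pi * ‖k‖) ^ 2 + m ^ 2) ^ (-ε)

theorem memLp_smoothingSymbol_smul {m ε : ℝ} (hm : 0 < m) (hε : 0 ≤ ε)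
    (f : Lp (α := Space) ℂ 2) :
    MemLp (fun k : Space => (smoothingSymbol m ε k : ℂ) * f k) 2 volume := by
  have hpos : ∀ k : Space, 0 < (2 * Real.pi * ‖k‖) ^ 2 + m ^ 2 := fun k => by positivity
  have hcont : Continuous (fun k : Space => (smoothingSymbol m ε k : ℂ)) := by
    unfold smoothingSymbol
    refine Complex.continuous_ofReal.comp (Continuous.rpow_const (by fun_prop) ?_)
    exact fun k => Or.inl (hpos k).ne'
  refine (Lp.memLp f).of_le_mul (c := (m ^ 2) ^ (-ε))
    (hcont.aestronglyMeasurable.mul (Lp.aestronglyMeasurable f)) (ae_of_all _ fun k => ?_)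
  rw [norm_mul, Complex.norm_real, Real.norm_eq_abs, smoothingSymbol,
    abs_of_nonneg (Real.rpow_nonneg (hpos k).le _)]
  refine mul_le_mul_of_nonneg_right ?_ (norm_nonneg _)
  exact Real.rpow_le_rpow_of_nonpos (by positivity) (by nlinarith [sq_nonneg (2 * Real.pi * ‖k‖)])
    (by linarith)

/-- The smoothing operator `K_m^ε = (-Δ + m²)^{-ε}`, `m > 0`, `ε ≥ 0`, on `L²(ℝ³)`: the Fourier
multiplier with symbol `(|ξ|² + m²)^{-ε}`, where the Fourier transform is that of `L²` (Plancherel).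
-/
def smoothing (m ε : ℝ) (hm : 0 < m) (hε : 0 ≤ ε) (f : Lp (α := Space) ℂ 2) :
    Lp (α := Space) ℂ 2 :=
  𝓕⁻ (memLp_smoothingSymbol_smul hm hε (𝓕 f)).toLp

/-- `f(x) → c` as `x → 0`, for an almost everywhere class `f`: for every `δ > 0` there is a
neighbourhood of `0` at almost every point `x` of which `|f(x) - c| < δ`. This does not depend on the
choice of a representative, and it holds if and only if some representative has limit `c` at `0`. -/
def EssTendstoAtZero (f : Lp (α := Space) ℂ 2) (c : ℂ) : Prop :=
  Tendsto (fun x : Space => f x) (𝓝 0 ⊓ ae volume) (𝓝 c)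

end DiracPoint

end

/-!
Inside the ball of radius `t` the function `ψ = g - γ(·,t)` equals
`(e^{-m|x|} - 1)/(4π|x|) + (m/4π) ∫ J₁(m√(s²-|x|²))/√(s²-|x|²) ds`, the integral being over
`|x| < s < t`. Since `J₁(√u)/√u` is an entire function of `u` (`besselQuotient`), the integral is a
continuous function of `x`, and `ψ` has the stated limit `limitValue m t` at the origin.
Outside the ball `ψ = g`. Hence `ψ` is bounded by a multiple of `e^{-m|x|}` and is continuous away
from the origin and from the sphere `|x| = t`.

For `ε > 0` the identity `(a + m²)^{-ε} = Γ(ε)⁻¹ ∫₀^∞ s^{ε-1} e^{-m²s} e^{-as} ds` exhibits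
`(-Δ + m²)^{-ε}` as a superposition of heat operators, hence as the convolution with the positive
integrable kernel `besselKernel m ε` (`fourier_besselKernel`, `smoothing_toLp_ae_eq`). As the
multiplier is defined by the Fourier transform of `L²`, this also needs `fourier_toLp_ae_eq`: the
latter agrees with the Fourier integral on `L¹ ∩ L²`.

By dominated convergence the convolution tends to `∫ besselKernel m ε y * ψ(-y) dy` at the origin
(`tendsto_besselConv`). This integral is `∫ subordinator m ε s * Φ(s) ds`, where `Φ(s)` is the
average of `ψ` against the heat kernel at time `s`; `Φ` is bounded and tends to `limitValue m t` as
`s → 0+`. For each `η > 0` one has `|Φ(s) - limitValue m t| ≤ η + D s` for all `s > 0`, whereas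
`subordinator m ε` has mass `m^{-2ε} → 1` and first moment `ε m^{-2ε-2} → 0`. So the integral tends
to `limitValue m t` as `ε → 0+` (`tendsto_integral_besselKernel_mul`).
-/

noncomputable section

namespace DiracPoint

/-! ### The Bessel function of order one -/

/-- The entire function `u ↦ J₁(√u)/√u`, given by its power series. -/
def besselQuotient (u : ℝ) : ℝ :=
  ∑' k : ℕ, (-1 : ℝ) ^ k / ((k ! : ℝ) * ((k + 1)! : ℝ)) * (u / 4) ^ k / 2

theorem besselJ_one_eq (z : ℝ) : besselJ 1 z = z * besselQuotient (z ^ 2) := by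
  rw [besselJ, besselQuotient, ← tsum_mul_left]
  refine tsum_congr fun k => ?_
  rw [pow_succ, pow_mul, show (z / 2) ^ 2 = z ^ 2 / 4 by ring]
  ring

theorem continuous_besselQuotient : Continuous besselQuotient := by
  rw [continuous_iff_continuousAt]
  intro u₀
  have hball : Metric.ball (0 : ℝ) (|u₀| + 1) ∈ 𝓝 u₀ :=
    Metric.isOpen_ball.mem_nhds (by simp)
  refine ContinuousOn.continuousAt (s := Metric.ball 0 (|u₀| + 1)) ?_ hball
  refine continuousOn_tsum (u := fun k : ℕ => ((|u₀| + 1) / 4) ^ k / (k ! : ℝ))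
    (fun k => by fun_prop) (Real.summable_pow_div_factorial _) fun k u hu => ?_
  have hu' : |u| ≤ |u₀| + 1 := by
    simpa using (Metric.mem_ball.1 hu).le
  have h1 : (1 : ℝ) ≤ ((k + 1)! : ℝ) := by exact_mod_cast (k + 1).factorial_pos
  have h2 : (0 : ℝ) < (k ! : ℝ) := by exact_mod_cast k.factorial_pos
  rw [norm_div, norm_mul, norm_div, norm_pow, norm_pow, norm_neg, norm_one, one_pow,
    Real.norm_eq_abs (u / 4), abs_div, abs_of_pos (by norm_num : (0 : ℝ) < 4),
    Real.norm_of_nonneg (by positivity : (0 : ℝ) ≤ (k ! : ℝ) * ((k + 1)! : ℝ)),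
    Real.norm_of_nonneg (by norm_num : (0 : ℝ) ≤ 2)]
  have h3 : (|u| / 4) ^ k ≤ ((|u₀| + 1) / 4) ^ k := by gcongr
  calc 1 / ((k ! : ℝ) * ((k + 1)! : ℝ)) * (|u| / 4) ^ k / 2
      ≤ 1 / ((k ! : ℝ) * 1) * ((|u₀| + 1) / 4) ^ k / 1 := by gcongr; norm_num
    _ = _ := by ring

/-- The kernel of the propagator inside the light cone is an entire function of `s² - r²`. -/
theorem besselJ_one_mul_div {m r s : ℝ} (hr : 0 ≤ r) (hs : r < s) :
    besselJ 1 (m * √(s ^ 2 - r ^ 2)) / √(s ^ 2 - r ^ 2)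
      = m * besselQuotient (m ^ 2 * (s ^ 2 - r ^ 2)) := by
  have h : 0 < s ^ 2 - r ^ 2 := by nlinarith
  have h' : √(s ^ 2 - r ^ 2) ≠ 0 := (Real.sqrt_pos.2 h).ne'
  rw [besselJ_one_eq, mul_pow, Real.sq_sqrt h.le]
  field_simp

/-! ### The propagator inside the light cone -/

/-- The integral of the Klein–Gordon propagator inside the light cone, as a function of the
distance `r` to the source. -/
def lightConeIntegral (m t r : ℝ) : ℝ :=
  ∫ s in (0 : ℝ)..t, heaviside (s - r) * (m * besselQuotient (m ^ 2 * (s ^ 2 - r ^ 2)))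

theorem measurable_heaviside : Measurable heaviside :=
  Measurable.ite measurableSet_Ici measurable_const measurable_const

theorem continuousAt_heaviside {r : ℝ} (hr : r ≠ 0) : ContinuousAt heaviside r := by
  rcases lt_or_gt_of_ne hr with h | h
  · refine (continuousAt_const (y := (0 : ℝ))).congr ?_
    filter_upwards [Iio_mem_nhds h] with x hx
    simp [heaviside, not_le.2 (Set.mem_Iio.1 hx)]
  · refine (continuousAt_const (y := (1 : ℝ))).congr ?_
    filter_upwards [Ioi_mem_nhds h] with x hx
    simp [heaviside, (Set.mem_Ioi.1 hx).le]

/-- The two integrands differ only at `s = r`, where `J₁(0)/0` takes the junk value `0`. -/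
theorem kleinGordonGamma_eq (m t : ℝ) (x : Space) :
    kleinGordonGamma m x t
      = heaviside (t - ‖x‖) / (4 * Real.pi * ‖x‖)
        - m / (4 * Real.pi) * lightConeIntegral m t ‖x‖ := by
  rw [kleinGordonGamma, lightConeIntegral]
  congr 2
  refine intervalIntegral.integral_congr_ae ?_
  have hne : ∀ᵐ s : ℝ, s ≠ ‖x‖ := by simp [ae_iff, measure_singleton]
  filter_upwards [hne] with s hs _
  rcases lt_or_gt_of_ne hs with h | h
  · simp [heaviside, not_le.2 h]
  · rw [mul_div_assoc, besselJ_one_mul_div (norm_nonneg x) h]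

theorem measurable_lightCone_integrand (m r : ℝ) :
    Measurable fun s : ℝ =>
      heaviside (s - r) * (m * besselQuotient (m ^ 2 * (s ^ 2 - r ^ 2))) := by
  have h1 := measurable_heaviside
  have h2 := continuous_besselQuotient.measurable
  fun_prop

theorem exists_lightCone_bound (m t : ℝ) : ∃ C : ℝ, 0 ≤ C ∧ ∀ r s : ℝ, 0 ≤ r → 0 < s → s ≤ t →
    |heaviside (s - r) * (m * besselQuotient (m ^ 2 * (s ^ 2 - r ^ 2)))| ≤ C := by
  obtain ⟨C, hC⟩ := (isCompact_Icc (a := (0 : ℝ)) (b := m ^ 2 * t ^ 2)).exists_bound_of_continuousOn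
    continuous_besselQuotient.continuousOn
  refine ⟨|m| * |C|, by positivity, fun r s hr hs hst => ?_⟩
  by_cases h : 0 ≤ s - r
  · rw [heaviside, if_pos h, one_mul, abs_mul]
    refine mul_le_mul_of_nonneg_left ((hC _ ⟨?_, ?_⟩).trans (le_abs_self C)) (abs_nonneg m)
    · exact mul_nonneg (sq_nonneg m) (by nlinarith)
    · exact mul_le_mul_of_nonneg_left (by nlinarith [sq_nonneg r]) (sq_nonneg m)
  · rw [heaviside, if_neg h, zero_mul, abs_zero]
    positivity

theorem exists_lightConeIntegral_bound (m t : ℝ) (ht : 0 < t) :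
    ∃ C : ℝ, 0 ≤ C ∧ ∀ r : ℝ, 0 ≤ r → |lightConeIntegral m t r| ≤ C := by
  obtain ⟨C, hC0, hC⟩ := exists_lightCone_bound m t
  refine ⟨C * |t - 0|, by positivity, fun r hr => ?_⟩
  rw [lightConeIntegral, ← Real.norm_eq_abs]
  refine intervalIntegral.norm_integral_le_of_norm_le_const fun s hs => ?_
  rw [Set.uIoc_of_le ht.le] at hs
  exact hC r s hr hs.1 hs.2

theorem lightConeIntegral_eq_zero {m t r : ℝ} (ht : 0 < t) (hr : t < r) :
    lightConeIntegral m t r = 0 := by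
  rw [lightConeIntegral, intervalIntegral.integral_congr (g := fun _ => 0)]
  · simp
  · intro s hs
    rw [Set.uIcc_of_le ht.le] at hs
    have : ¬ 0 ≤ s - r := by linarith [hs.2]
    simp [heaviside, this]

/-- The Heaviside jump of the integrand at `s = ‖x‖` is a null set of `s`, so that dominated
convergence gives continuity everywhere, including at `x = 0` and on the sphere `‖x‖ = t`. -/
theorem continuous_lightConeIntegral_norm (m t : ℝ) (ht : 0 < t) :
    Continuous fun x : Space => lightConeIntegral m t ‖x‖ := by
  obtain ⟨C, hC0, hC⟩ := exists_lightCone_bound m t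
  rw [continuous_iff_continuousAt]
  intro x₀
  refine intervalIntegral.continuousAt_of_dominated_interval (bound := fun _ => C) ?_ ?_ ?_ ?_
  · exact Eventually.of_forall fun x => (measurable_lightCone_integrand m ‖x‖).aestronglyMeasurable
  · refine Eventually.of_forall fun x => ae_of_all _ fun s hs => ?_
    rw [Set.uIoc_of_le ht.le] at hs
    exact hC _ s (norm_nonneg x) hs.1 hs.2
  · exact intervalIntegrable_const
  · have hne : ∀ᵐ s : ℝ, s ≠ ‖x₀‖ := by simp [ae_iff, measure_singleton]
    filter_upwards [hne] with s hs _
    have h1 : ContinuousAt (fun x : Space => heaviside (s - ‖x‖)) x₀ :=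
      ContinuousAt.comp (f := fun x : Space => s - ‖x‖)
        (continuousAt_heaviside (sub_ne_zero.2 hs)) (by fun_prop)
    have h2 := continuous_besselQuotient
    exact h1.mul (by fun_prop)

theorem lightConeIntegral_zero (m t : ℝ) (ht : 0 < t) :
    lightConeIntegral m t 0 = ∫ s in (0 : ℝ)..t, m * besselQuotient (m ^ 2 * s ^ 2) := by
  rw [lightConeIntegral]
  refine intervalIntegral.integral_congr fun s hs => ?_
  rw [Set.uIcc_of_le ht.le] at hs
  simp [heaviside, hs.1]

/-! ### The difference of the Green function and the propagator -/

/-- The function `g - γ(·,t)`, with complex values. -/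
def greenDiff (m t : ℝ) (x : Space) : ℂ :=
  ((green m x - kleinGordonGamma m x t : ℝ) : ℂ)

theorem green_sub_kleinGordonGamma (m t : ℝ) (x : Space) :
    green m x - kleinGordonGamma m x t
      = (Real.exp (-m * ‖x‖) - heaviside (t - ‖x‖)) / (4 * Real.pi * ‖x‖)
        + m / (4 * Real.pi) * lightConeIntegral m t ‖x‖ := by
  rw [kleinGordonGamma_eq m t, green]
  ring

theorem measurable_greenDiff (m t : ℝ) (ht : 0 < t) : Measurable (greenDiff m t) := by
  refine Complex.measurable_ofReal.comp ?_
  simp_rw [green_sub_kleinGordonGamma m t]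
  have h1 := measurable_heaviside
  have h2 := (continuous_lightConeIntegral_norm m t ht).measurable
  fun_prop

theorem continuousAt_greenDiff (m t : ℝ) (ht : 0 < t) {x : Space} (hx : x ≠ 0) (hxt : ‖x‖ ≠ t) :
    ContinuousAt (greenDiff m t) x := by
  refine Complex.continuous_ofReal.continuousAt.comp ?_
  simp_rw [green_sub_kleinGordonGamma m t]
  have h1 : ContinuousAt (fun x : Space => heaviside (t - ‖x‖)) x :=
    ContinuousAt.comp (f := fun x : Space => t - ‖x‖)
      (continuousAt_heaviside (sub_ne_zero.2 hxt.symm)) (by fun_prop)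
  have h2 := (continuous_lightConeIntegral_norm m t ht).continuousAt (x := x)
  have h3 : 4 * Real.pi * ‖x‖ ≠ 0 := by
    have := norm_pos_iff.2 hx
    positivity
  exact ((ContinuousAt.sub (by fun_prop) h1).div (by fun_prop) h3).add (continuousAt_const.mul h2)

/-- Inside the ball of radius `t` the singularities `1/(4π‖x‖)` of `g` and `γ` cancel; outside it
`γ` vanishes and `g` is bounded by a multiple of `e^{-m‖x‖}`. -/
theorem exists_greenDiff_bound (m t : ℝ) (hm : 0 < m) (ht : 0 < t) :
    ∃ C : ℝ, ∀ x : Space, ‖greenDiff m t x‖ ≤ C * Real.exp (-m * ‖x‖) := by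
  obtain ⟨C, hC0, hC⟩ := exists_lightConeIntegral_bound m t ht
  have hpi := Real.pi_pos
  refine ⟨(m / (4 * Real.pi) + m / (4 * Real.pi) * C) * Real.exp (m * t)
    + 1 / (4 * Real.pi * t), fun x => ?_⟩
  rw [greenDiff, Complex.norm_real, Real.norm_eq_abs, green_sub_kleinGordonGamma m t]
  set r := ‖x‖ with hr
  have hr0 : 0 ≤ r := norm_nonneg x
  rcases le_or_gt r t with h | h
  · have hexp : 1 ≤ Real.exp (m * t) * Real.exp (-m * r) := by
      rw [← Real.exp_add]
      exact Real.one_le_exp (by nlinarith)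
    have hheav : heaviside (t - r) = 1 := by simp [heaviside, h]
    have h1 : |(Real.exp (-m * r) - heaviside (t - r)) / (4 * Real.pi * r)|
        ≤ m / (4 * Real.pi) := by
      rw [hheav]
      rcases hr0.eq_or_lt with h0 | h0
      · rw [← h0]
        simp only [mul_zero, div_zero, abs_zero]
        positivity
      · rw [abs_div, abs_of_pos (by positivity : 0 < 4 * Real.pi * r), abs_sub_comm, abs_of_nonneg
          (sub_nonneg.2 (Real.exp_le_one_iff.2 (by nlinarith))),
          div_le_div_iff₀ (by positivity) (by positivity)]
        have := Real.add_one_le_exp (-m * r)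
        have h4 : 1 - Real.exp (-m * r) ≤ m * r := by linarith
        calc (1 - Real.exp (-m * r)) * (4 * Real.pi) ≤ m * r * (4 * Real.pi) := by gcongr
          _ = _ := by ring
    have h2 : |m / (4 * Real.pi) * lightConeIntegral m t r| ≤ m / (4 * Real.pi) * C := by
      rw [abs_mul, abs_of_nonneg (by positivity : 0 ≤ m / (4 * Real.pi))]
      exact mul_le_mul_of_nonneg_left (hC r hr0) (by positivity)
    calc _ ≤ m / (4 * Real.pi) + m / (4 * Real.pi) * C := (abs_add_le _ _).trans (add_le_add h1 h2)
      _ ≤ (m / (4 * Real.pi) + m / (4 * Real.pi) * C) * (Real.exp (m * t) * Real.exp (-m * r)) :=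
        le_mul_of_one_le_right (by positivity) hexp
      _ ≤ _ := by
        have : 0 ≤ 1 / (4 * Real.pi * t) * Real.exp (-m * r) := by positivity
        linarith
  · have hr' : 0 < r := ht.trans h
    have hheav : heaviside (t - r) = 0 := by simp [heaviside, h]
    rw [hheav, lightConeIntegral_eq_zero ht h, mul_zero, add_zero, sub_zero, abs_div, Real.abs_exp,
      abs_of_pos (by positivity : 0 < 4 * Real.pi * r)]
    calc Real.exp (-m * r) / (4 * Real.pi * r) ≤ Real.exp (-m * r) / (4 * Real.pi * t) := by gcongr
      _ = 1 / (4 * Real.pi * t) * Real.exp (-m * r) := by ring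
      _ ≤ _ := mul_le_mul_of_nonneg_right (le_add_of_nonneg_left (by positivity)) (Real.exp_nonneg _)

theorem integrable_exp_neg_mul_norm {m : ℝ} (hm : 0 < m) :
    Integrable fun x : Space => Real.exp (-m * ‖x‖) := by
  refine (integrable_fun_norm_addHaar volume (f := fun r => Real.exp (-m * r))).2 ?_
  have h := integrableOn_rpow_mul_exp_neg_mul_rpow (p := 1) (s := 2) (b := m)
    (by norm_num) one_pos hm
  simpa using h

theorem integrable_greenDiff (m t : ℝ) (hm : 0 < m) (ht : 0 < t) :
    Integrable (greenDiff m t) := by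
  obtain ⟨C, hC⟩ := exists_greenDiff_bound m t hm ht
  exact ((integrable_exp_neg_mul_norm hm).const_mul C).mono'
    (measurable_greenDiff m t ht).aestronglyMeasurable (ae_of_all _ hC)

theorem exists_norm_greenDiff_le (m t : ℝ) (hm : 0 < m) (ht : 0 < t) :
    ∃ C : ℝ, ∀ x : Space, ‖greenDiff m t x‖ ≤ C := by
  obtain ⟨C, hC⟩ := exists_greenDiff_bound m t hm ht
  refine ⟨|C|, fun x => (hC x).trans ?_⟩
  have h1 : Real.exp (-m * ‖x‖) ≤ 1 :=
    Real.exp_le_one_iff.2 (by nlinarith [norm_nonneg x])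
  calc C * Real.exp (-m * ‖x‖) ≤ |C| * 1 := by
        gcongr
        exact le_abs_self C
    _ = |C| := mul_one _

/-- The discontinuities are the origin and the wave front `‖x‖ = t`. -/
theorem ae_continuousAt_greenDiff (m t : ℝ) (ht : 0 < t) :
    ∀ᵐ x : Space, ContinuousAt (greenDiff m t) x := by
  have h0 : ∀ᵐ x : Space, x ≠ 0 := by simp [ae_iff, measure_singleton]
  have ht' : ∀ᵐ x : Space, ‖x‖ ≠ t := by
    have h := Measure.addHaar_sphere (volume : Measure Space) 0 t
    rw [measure_eq_zero_iff_ae_notMem] at h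
    simpa using h
  filter_upwards [h0, ht'] with x hx hxt
  exact continuousAt_greenDiff m t ht hx hxt

theorem tendsto_green_sub_kleinGordonGamma (m t : ℝ) (ht : 0 < t) :
    Tendsto (fun x : Space => green m x - kleinGordonGamma m x t) (𝓝[≠] 0)
      (𝓝 (-(m / (4 * Real.pi)) + m / (4 * Real.pi) * lightConeIntegral m t 0)) := by
  simp_rw [green_sub_kleinGordonGamma m t]
  refine Tendsto.add ?_ ?_
  · -- the difference quotient of `r ↦ e^{-mr}` at `r = 0`
    have hd : HasDerivAt (fun r : ℝ => Real.exp (-m * r)) (-m) 0 := by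
      simpa using ((hasDerivAt_id (0 : ℝ)).const_mul (-m)).exp
    have hs := (hasDerivAt_iff_tendsto_slope.1 hd).comp 
      ((tendsto_norm_nhdsNE_zero (E := Space)).mono_right
        (nhdsWithin_mono _ fun _ hr => ne_of_gt hr))
    have hs' := hs.div_const (4 * Real.pi)
    rw [neg_div] at hs'
    refine hs'.congr' ?_
    have hball : ∀ᶠ x : Space in 𝓝[≠] 0, ‖x‖ < t :=
      nhdsWithin_le_nhds (mem_of_superset (Metric.ball_mem_nhds (0 : Space) ht)
        fun x hx => by simpa using hx)
    filter_upwards [hball] with x hx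
    simp only [Function.comp, slope_def_field, mul_zero, Real.exp_zero, sub_zero, heaviside,
      sub_nonneg.2 hx.le, if_true]
    rw [div_div, mul_comm ‖x‖]
  · have h := ((continuous_lightConeIntegral_norm m t ht).tendsto 0).const_mul (m / (4 * Real.pi))
    rw [norm_zero] at h
    exact h.mono_left nhdsWithin_le_nhds

/-! ### The heat kernel and the Bessel kernel -/

/-- The heat kernel of `-Δ` on `ℝ³` at time `s`. -/
def heatKernel (s : ℝ) (x : Space) : ℝ :=
  (4 * Real.pi * s) ^ (-(3 / 2) : ℝ) * Real.exp (-(1 / (4 * s)) * ‖x‖ ^ 2)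

theorem heatKernel_nonneg {s : ℝ} (hs : 0 < s) (x : Space) : 0 ≤ heatKernel s x := by
  unfold heatKernel
  positivity

theorem integral_heatKernel {s : ℝ} (hs : 0 < s) : ∫ x, heatKernel s x = 1 := by
  simp only [heatKernel]
  rw [integral_const_mul, GaussianFourier.integral_rexp_neg_mul_sq_norm (by positivity),
    finrank_euclideanSpace_fin]
  have h : Real.pi / (1 / (4 * s)) = 4 * Real.pi * s := by field_simp
  rw [h, ← Real.rpow_add (by positivity)]
  norm_num

theorem integrable_heatKernel {s : ℝ} (hs : 0 < s) : Integrable (heatKernel s) :=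
  Integrable.of_integral_ne_zero (by rw [integral_heatKernel hs]; exact one_ne_zero)

theorem fourier_heatKernel {s : ℝ} (hs : 0 < s) (k : Space) :
    𝓕 (fun x => (heatKernel s x : ℂ)) k = (Real.exp (-((2 * Real.pi * ‖k‖) ^ 2 * s)) : ℂ) := by
  have hb : 0 < ((1 / (4 * s) : ℝ) : ℂ).re := by rw [Complex.ofReal_re]; positivity
  have h := fourier_gaussian_innerProductSpace (V := Space) hb k
  have hf : (fun x : Space => (heatKernel s x : ℂ)) = (((4 * Real.pi * s) ^ (-(3 / 2) : ℝ) : ℝ) : ℂ) •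
      fun x : Space => Complex.exp (-((1 / (4 * s) : ℝ) : ℂ) * ‖x‖ ^ 2) := by
    funext x
    simp [heatKernel]
  have hpi := Real.pi_pos
  have h4 : (0 : ℝ) < 4 * Real.pi * s := by positivity
  have h1 : (Real.pi : ℂ) / ((1 / (4 * s) : ℝ) : ℂ) = ((4 * Real.pi * s : ℝ) : ℂ) := by
    rw [← Complex.ofReal_div]
    congr 1
    field_simp
  have h2 : ((Module.finrank ℝ Space : ℂ) / 2) = ((3 / 2 : ℝ) : ℂ) := by
    rw [finrank_euclideanSpace_fin]
    norm_num
  have h3 : -(Real.pi : ℂ) ^ 2 * (‖k‖ : ℂ) ^ 2 / ((1 / (4 * s) : ℝ) : ℂ)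
      = ((-((2 * Real.pi * ‖k‖) ^ 2 * s) : ℝ) : ℂ) := by
    have : (s : ℂ) ≠ 0 := by exact_mod_cast hs.ne'
    push_cast
    field_simp
    ring
  have hsmul : ∀ (c : ℂ) (f : Space → ℂ), 𝓕 (c • f) k = c • 𝓕 f k := fun c f =>
    congrFun (VectorFourier.fourierIntegral_const_smul _ _ _ f c) k
  rw [hf, hsmul, h, h1, h2, h3, ← Complex.ofReal_cpow h4.le, ← Complex.ofReal_exp,
    smul_eq_mul, ← mul_assoc, ← Complex.ofReal_mul, ← Real.rpow_add h4]
  norm_num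

/-- The heat kernel at time `s` is the dilation by `√s` of the heat kernel at time `1`. -/
theorem integral_heatKernel_mul {s : ℝ} (hs : 0 < s) (f : Space → ℂ) :
    ∫ x, (heatKernel s x : ℂ) * f x = ∫ x, (heatKernel 1 x : ℂ) * f (√s • x) := by
  have h := Measure.integral_comp_smul (volume : Measure Space)
    (fun x => (heatKernel s x : ℂ) * f x) (√s)
  have hs3 : (0 : ℝ) < √s ^ 3 := by positivity
  have hscale : ∀ x : Space, heatKernel s (√s • x) = (√s ^ 3)⁻¹ * heatKernel 1 x := by
    intro x
    have h1 : (s : ℝ) ^ (-(3 / 2) : ℝ) = (√s ^ 3)⁻¹ := by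
      rw [Real.sqrt_eq_rpow, ← Real.rpow_natCast, ← Real.rpow_mul hs.le, ← Real.rpow_neg hs.le]
      norm_num
    rw [heatKernel, heatKernel, norm_smul, mul_pow, Real.norm_of_nonneg (Real.sqrt_nonneg s),
      Real.sq_sqrt hs.le, Real.mul_rpow (by positivity) hs.le, h1]
    have : -(1 / (4 * s)) * (s * ‖x‖ ^ 2) = -(1 / (4 * 1)) * ‖x‖ ^ 2 := by field_simp
    rw [this, mul_one (4 * Real.pi), mul_comm _ (√s ^ 3)⁻¹, mul_assoc]
  simp_rw [hscale] at h
  rw [finrank_euclideanSpace_fin, abs_of_pos (inv_pos.2 hs3)] at h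
  have h' : ((√s ^ 3)⁻¹ : ℝ) • ∫ x, (heatKernel 1 x : ℂ) * f (√s • x)
      = ((√s ^ 3)⁻¹ : ℝ) • ∫ x, (heatKernel s x : ℂ) * f x := by
    rw [← h, ← integral_smul]
    refine integral_congr_ae (ae_of_all _ fun x => ?_)
    simp only [Complex.real_smul]
    push_cast
    ring
  exact (smul_right_injective ℂ (inv_pos.2 hs3).ne' h').symm

theorem tendsto_integral_heatKernel_mul {f : Space → ℂ} (hf : Measurable f) {C : ℝ}
    (hC : ∀ x, ‖f x‖ ≤ C) {L : ℂ} (hL : Tendsto f (𝓝[≠] 0) (𝓝 L)) :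
    Tendsto (fun s => ∫ x, (heatKernel s x : ℂ) * f x) (𝓝[>] 0) (𝓝 L) := by
  have hlim : ∫ x, (heatKernel 1 x : ℂ) * L = L := by
    rw [integral_mul_const, integral_complex_ofReal, integral_heatKernel one_pos]
    simp
  have key : Tendsto (fun s : ℝ => ∫ x, (heatKernel 1 x : ℂ) * f (√s • x)) (𝓝[>] 0)
      (𝓝 (∫ x, (heatKernel 1 x : ℂ) * L)) := by
    refine tendsto_integral_filter_of_dominated_convergence (fun x => heatKernel 1 x * C) ?_ ?_ ?_ ?_
    · refine Eventually.of_forall fun s => ?_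
      exact (integrable_heatKernel one_pos).ofReal.aestronglyMeasurable.mul
        (hf.comp (measurable_const_smul _)).aestronglyMeasurable
    · refine Eventually.of_forall fun s => ae_of_all _ fun x => ?_
      rw [norm_mul, Complex.norm_real, Real.norm_of_nonneg (heatKernel_nonneg one_pos x)]
      exact mul_le_mul_of_nonneg_left (hC _) (heatKernel_nonneg one_pos x)
    · exact (integrable_heatKernel one_pos).mul_const C
    · have h0 : ∀ᵐ x : Space, x ≠ 0 := by simp [ae_iff, measure_singleton]
      filter_upwards [h0] with x hx
      refine tendsto_const_nhds.mul (hL.comp ?_)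
      refine tendsto_nhdsWithin_iff.2 ⟨?_, ?_⟩
      · have hc : Continuous fun s : ℝ => √s • x := by fun_prop
        have := hc.tendsto 0
        simp only [Real.sqrt_zero, zero_smul] at this
        exact this.mono_left nhdsWithin_le_nhds
      · filter_upwards [self_mem_nhdsWithin] with s hs
        exact smul_ne_zero (Real.sqrt_pos.2 hs).ne' hx
  rw [hlim] at key
  refine key.congr' ?_
  filter_upwards [self_mem_nhdsWithin] with s hs
  exact (integral_heatKernel_mul hs f).symm

/-- The density in `s` which represents a negative power as a superposition of exponentials:
`(a + m²)^{-ε} = ∫₀^∞ e^{-as} subordinator m ε s ds`. -/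
def subordinator (m ε s : ℝ) : ℝ :=
  s ^ (ε - 1) * Real.exp (-(m ^ 2 * s)) / Real.Gamma ε

theorem subordinator_nonneg (m : ℝ) {ε s : ℝ} (hε : 0 < ε) (hs : 0 < s) :
    0 ≤ subordinator m ε s := by
  have := Real.Gamma_pos_of_pos hε
  unfold subordinator
  positivity

theorem measurable_subordinator (m ε : ℝ) : Measurable (subordinator m ε) := by
  unfold subordinator
  fun_prop

theorem integral_subordinator_mul_exp {m ε a : ℝ} (hm : 0 < m) (hε : 0 < ε) (ha : 0 ≤ a) :
    ∫ s in Set.Ioi 0, subordinator m ε s * Real.exp (-(a * s)) = (a + m ^ 2) ^ (-ε) := by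
  have hG := Real.Gamma_pos_of_pos hε
  have hr : 0 < a + m ^ 2 := by positivity
  have h := Real.integral_rpow_mul_exp_neg_mul_Ioi hε hr
  have h2 : ∀ s : ℝ, subordinator m ε s * Real.exp (-(a * s))
      = (Real.Gamma ε)⁻¹ * (s ^ (ε - 1) * Real.exp (-((a + m ^ 2) * s))) := by
    intro s
    rw [subordinator, show -((a + m ^ 2) * s) = -(m ^ 2 * s) + -(a * s) by ring, Real.exp_add]
    ring
  simp_rw [h2]
  rw [integral_const_mul, h, one_div, Real.inv_rpow hr.le, Real.rpow_neg hr.le]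
  field_simp

theorem integral_subordinator {m ε : ℝ} (hm : 0 < m) (hε : 0 < ε) :
    ∫ s in Set.Ioi 0, subordinator m ε s = (m ^ 2) ^ (-ε) := by
  simpa using integral_subordinator_mul_exp hm hε le_rfl

theorem integrableOn_subordinator {m ε : ℝ} (hm : 0 < m) (hε : 0 < ε) :
    IntegrableOn (subordinator m ε) (Set.Ioi 0) := by
  refine Integrable.of_integral_ne_zero ?_
  rw [integral_subordinator hm hε]
  positivity

/-- The first moment of `subordinator m ε` is `ε` times the mass of `subordinator m (ε + 1)`; this
is the source of the smallness as `ε → 0+`. -/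
theorem mul_subordinator {m ε s : ℝ} (hε : 0 < ε) (hs : 0 < s) :
    s * subordinator m ε s = ε * subordinator m (ε + 1) s := by
  have hG := Real.Gamma_pos_of_pos hε
  rw [subordinator, subordinator, Real.Gamma_add_one hε.ne', add_sub_cancel_right,
    Real.rpow_sub_one hs.ne']
  field_simp

/-- The measures `subordinator m ε s ds` on `(0, ∞)` concentrate at `0` as `ε → 0+`. -/
theorem tendsto_integral_subordinator_mul {m : ℝ} (hm : 0 < m) {Φ : ℝ → ℂ}
    (hΦ : ∀ ε, 0 < ε → IntegrableOn (fun s => (subordinator m ε s : ℂ) * Φ s) (Set.Ioi 0)) {C : ℝ}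
    (hC : ∀ s, 0 < s → ‖Φ s‖ ≤ C) {L : ℂ} (hL : Tendsto Φ (𝓝[>] 0) (𝓝 L)) :
    Tendsto (fun ε => ∫ s in Set.Ioi 0, (subordinator m ε s : ℂ) * Φ s) (𝓝[>] 0) (𝓝 L) := by
  have hmass : Tendsto (fun ε : ℝ => (m ^ 2) ^ (-ε)) (𝓝[>] 0) (𝓝 1) := by
    have hc : Continuous fun ε : ℝ => (m ^ 2) ^ (-ε) :=
      Continuous.rpow continuous_const continuous_neg fun _ => Or.inl (by positivity)
    simpa using (hc.tendsto 0).mono_left nhdsWithin_le_nhds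
  have hmom : Tendsto (fun ε : ℝ => ε * (m ^ 2) ^ (-(ε + 1))) (𝓝[>] 0) (𝓝 0) := by
    have hc : Continuous fun ε : ℝ => ε * (m ^ 2) ^ (-(ε + 1)) :=
      continuous_id.mul (Continuous.rpow continuous_const (by fun_prop)
        fun _ => Or.inl (by positivity))
    simpa using (hc.tendsto 0).mono_left nhdsWithin_le_nhds
  have hmassL : Tendsto (fun ε : ℝ => (((m ^ 2) ^ (-ε) : ℝ) : ℂ) * L) (𝓝[>] 0) (𝓝 L) := by
    simpa using ((Complex.continuous_ofReal.tendsto 1).comp hmass).mul_const L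
  have hC0 : 0 ≤ C := (norm_nonneg _).trans (hC 1 one_pos)
  suffices hdiff : Tendsto (fun ε => (∫ s in Set.Ioi 0, (subordinator m ε s : ℂ) * Φ s)
      - (((m ^ 2) ^ (-ε) : ℝ) : ℂ) * L) (𝓝[>] 0) (𝓝 0) by
    simpa using hdiff.add hmassL
  -- the linear term `D s` absorbs the `s` away from `0` and has a small first moment
  have hlin : ∀ η > 0, ∃ D : ℝ, ∀ s, 0 < s → ‖Φ s - L‖ ≤ η + D * s := by
    intro η hη
    obtain ⟨δ, hδ, hδL⟩ := Metric.mem_nhdsWithin_iff.1 (hL (Metric.closedBall_mem_nhds L hη))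
    refine ⟨(C + ‖L‖) / δ, fun s hs => ?_⟩
    have hD : 0 ≤ (C + ‖L‖) / δ * s := by positivity
    by_cases h : s < δ
    · have : Φ s ∈ Metric.closedBall L η := hδL ⟨by simpa [abs_of_pos hs] using h, hs⟩
      rw [Metric.mem_closedBall, dist_eq_norm] at this
      linarith
    · have h1 : ‖Φ s - L‖ ≤ C + ‖L‖ := (norm_sub_le _ _).trans (by gcongr; exact hC s hs)
      have h2 : C + ‖L‖ ≤ (C + ‖L‖) / δ * s := by
        rw [div_mul_eq_mul_div, le_div_iff₀ hδ]
        exact mul_le_mul_of_nonneg_left (not_lt.1 h) (by positivity)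
      linarith
  have hbound : ∀ η > 0, ∃ D : ℝ, ∀ ε, 0 < ε →
      ‖(∫ s in Set.Ioi 0, (subordinator m ε s : ℂ) * Φ s) - (((m ^ 2) ^ (-ε) : ℝ) : ℂ) * L‖
        ≤ η * (m ^ 2) ^ (-ε) + D * (ε * (m ^ 2) ^ (-(ε + 1))) := by
    intro η hη
    obtain ⟨D, hD⟩ := hlin η hη
    refine ⟨D, fun ε hε => ?_⟩
    have hε1 : 0 < ε + 1 := by linarith
    have hw := integrableOn_subordinator hm hε
    have hw1 := integrableOn_subordinator hm hε1
    have hwL : Integrable (fun s => (subordinator m ε s : ℂ) * L)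
        (volume.restrict (Set.Ioi 0)) := (hw.ofReal (𝕜 := ℂ)).mul_const L
    have hsplit : (∫ s in Set.Ioi 0, (subordinator m ε s : ℂ) * Φ s)
        - (((m ^ 2) ^ (-ε) : ℝ) : ℂ) * L
        = ∫ s in Set.Ioi 0, (subordinator m ε s : ℂ) * (Φ s - L) := by
      rw [← integral_subordinator hm hε, ← integral_complex_ofReal, ← integral_mul_const,
        ← integral_sub (hΦ ε hε) hwL]
      refine integral_congr_ae (ae_of_all _ fun s => ?_)
      simp only
      ring
    rw [hsplit, ← integral_subordinator hm hε, ← integral_subordinator hm hε1,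
      ← integral_const_mul ε, ← integral_const_mul, ← integral_const_mul,
      ← integral_add (hw.const_mul η) ((hw1.const_mul ε).const_mul D)]
    refine norm_integral_le_of_norm_le ((hw.const_mul η).add ((hw1.const_mul ε).const_mul D)) ?_
    filter_upwards [ae_restrict_mem measurableSet_Ioi] with s hs
    have hw0 := subordinator_nonneg m hε hs
    rw [norm_mul, Complex.norm_real, Real.norm_of_nonneg hw0, ← mul_subordinator hε hs]
    calc subordinator m ε s * ‖Φ s - L‖ ≤ subordinator m ε s * (η + D * s) :=
          mul_le_mul_of_nonneg_left (hD s hs) hw0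
      _ = _ := by ring
  rw [Metric.tendsto_nhds]
  intro η hη
  obtain ⟨D, hD⟩ := hbound (η / 2) (by positivity)
  have hlim : Tendsto (fun ε : ℝ => η / 2 * (m ^ 2) ^ (-ε) + D * (ε * (m ^ 2) ^ (-(ε + 1))))
      (𝓝[>] 0) (𝓝 (η / 2)) := by
    simpa using (hmass.const_mul (η / 2)).add (hmom.const_mul D)
  filter_upwards [hlim.eventually_lt_const (half_lt_self hη), self_mem_nhdsWithin] with ε h1 hε
  rw [dist_zero_right]
  exact (hD ε hε).trans_lt h1

/-- The convolution kernel of `(-Δ + m²)^{-ε}`, as a superposition of heat kernels. -/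
def besselKernel (m ε : ℝ) (x : Space) : ℝ :=
  ∫ s in Set.Ioi 0, subordinator m ε s * heatKernel s x

theorem measurable_heatKernel : Measurable fun p : ℝ × Space => heatKernel p.1 p.2 := by
  unfold heatKernel
  fun_prop

theorem integrable_prod_subordinator_mul_heatKernel {m ε : ℝ} (hm : 0 < m) (hε : 0 < ε) :
    Integrable (fun p : ℝ × Space => subordinator m ε p.1 * heatKernel p.1 p.2)
      ((volume.restrict (Set.Ioi 0)).prod volume) := by
  have hmeas : AEStronglyMeasurable
      (fun p : ℝ × Space => subordinator m ε p.1 * heatKernel p.1 p.2)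
      ((volume.restrict (Set.Ioi 0)).prod volume) :=
    (((measurable_subordinator m ε).comp measurable_fst).mul
      measurable_heatKernel).aestronglyMeasurable
  refine (integrable_prod_iff hmeas).2 ⟨?_, ?_⟩
  · filter_upwards [ae_restrict_mem measurableSet_Ioi] with s hs
    exact (integrable_heatKernel hs).const_mul _
  · refine (integrableOn_subordinator hm hε).congr ?_
    filter_upwards [ae_restrict_mem measurableSet_Ioi] with s hs
    have h : ∀ x : Space, ‖subordinator m ε s * heatKernel s x‖
        = subordinator m ε s * heatKernel s x := fun x =>
      Real.norm_of_nonneg (mul_nonneg (subordinator_nonneg m hε hs) (heatKernel_nonneg hs x))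
    simp_rw [h]
    rw [integral_const_mul, integral_heatKernel hs, mul_one]

theorem integrable_besselKernel {m ε : ℝ} (hm : 0 < m) (hε : 0 < ε) :
    Integrable (besselKernel m ε) :=
  (integrable_prod_subordinator_mul_heatKernel hm hε).integral_prod_right

theorem integrable_prod_subordinator_mul_heatKernel_mul {m ε : ℝ} (hm : 0 < m) (hε : 0 < ε)
    {f : Space → ℂ} (hf : Measurable f) {C : ℝ} (hC : ∀ x, ‖f x‖ ≤ C) :
    Integrable (fun p : ℝ × Space =>
      (subordinator m ε p.1 : ℂ) * ((heatKernel p.1 p.2 : ℂ) * f p.2))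
      ((volume.restrict (Set.Ioi 0)).prod volume) := by
  have h := (integrable_prod_subordinator_mul_heatKernel hm hε).ofReal (𝕜 := ℂ)
  have h2 := h.mul_bdd (c := C) (g := fun p : ℝ × Space => f p.2)
    (hf.comp measurable_snd).aestronglyMeasurable (ae_of_all _ fun p => hC p.2)
  refine h2.congr (ae_of_all _ fun p => ?_)
  simp only [Complex.coe_algebraMap, Complex.ofReal_mul]
  ring

theorem integral_besselKernel_mul {m ε : ℝ} (hm : 0 < m) (hε : 0 < ε)
    {f : Space → ℂ} (hf : Measurable f) {C : ℝ} (hC : ∀ x, ‖f x‖ ≤ C) :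
    ∫ x, (besselKernel m ε x : ℂ) * f x
      = ∫ s in Set.Ioi 0, (subordinator m ε s : ℂ) * ∫ x, (heatKernel s x : ℂ) * f x := by
  have hswap := integral_integral_swap
    (f := fun (s : ℝ) (x : Space) => (subordinator m ε s : ℂ) * ((heatKernel s x : ℂ) * f x))
    (integrable_prod_subordinator_mul_heatKernel_mul hm hε hf hC)
  simp_rw [integral_const_mul] at hswap
  rw [hswap]
  refine integral_congr_ae (ae_of_all _ fun x => ?_)
  simp only [besselKernel]
  rw [← integral_complex_ofReal, ← integral_mul_const]
  refine integral_congr_ae (ae_of_all _ fun s => ?_)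
  simp only [Complex.ofReal_mul]
  ring

/-- The measures `besselKernel m ε x dx` concentrate at the origin as `ε → 0+`. -/
theorem tendsto_integral_besselKernel_mul {m : ℝ} (hm : 0 < m)
    {f : Space → ℂ} (hf : Measurable f) {C : ℝ} (hC : ∀ x, ‖f x‖ ≤ C) {L : ℂ}
    (hL : Tendsto f (𝓝[≠] 0) (𝓝 L)) :
    Tendsto (fun ε => ∫ x, (besselKernel m ε x : ℂ) * f x) (𝓝[>] 0) (𝓝 L) := by
  have hbound : ∀ s, 0 < s → ‖∫ x, (heatKernel s x : ℂ) * f x‖ ≤ C := by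
    intro s hs
    have h := norm_integral_le_of_norm_le (f := fun x => (heatKernel s x : ℂ) * f x)
      ((integrable_heatKernel hs).mul_const C) (ae_of_all _ fun x => by
        rw [norm_mul, Complex.norm_real, Real.norm_of_nonneg (heatKernel_nonneg hs x)]
        exact mul_le_mul_of_nonneg_left (hC _) (heatKernel_nonneg hs x))
    rwa [integral_mul_const, integral_heatKernel hs, one_mul] at h
  have hint : ∀ ε, 0 < ε → IntegrableOn
      (fun s => (subordinator m ε s : ℂ) * ∫ x, (heatKernel s x : ℂ) * f x) (Set.Ioi 0) := by
    intro ε hε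
    have h := (integrable_prod_subordinator_mul_heatKernel_mul hm hε hf hC).integral_prod_left
    simp_rw [integral_const_mul] at h
    exact h
  refine (tendsto_integral_subordinator_mul hm hint hbound
    (tendsto_integral_heatKernel_mul hf hC hL)).congr' ?_
  filter_upwards [self_mem_nhdsWithin] with ε hε
  exact (integral_besselKernel_mul hm hε hf hC).symm

/-- Fubini reduces the claim to the Fourier transform of a Gaussian and to the integral
representation of the power `(|ξ|² + m²)^{-ε}`. -/
theorem fourier_besselKernel {m ε : ℝ} (hm : 0 < m) (hε : 0 < ε) (k : Space) :
    𝓕 (fun x => (besselKernel m ε x : ℂ)) k = (smoothingSymbol m ε k : ℂ) := by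
  have hchar : ∀ g : Space → ℂ, 𝓕 g k = ∫ x, g x * Real.fourierChar (-inner ℝ x k) := by
    intro g
    rw [Real.fourier_eq]
    refine integral_congr_ae (ae_of_all _ fun x => ?_)
    simp only [Circle.smul_def, smul_eq_mul]
    ring
  have hmeas : Measurable fun x : Space => (Real.fourierChar (-inner ℝ x k) : ℂ) := by
    have hc : Continuous fun x : Space => (Real.fourierChar (-inner ℝ x k) : ℂ) :=
      continuous_subtype_val.comp (Real.continuous_fourierChar.comp (by fun_prop))
    exact hc.measurable
  rw [hchar, integral_besselKernel_mul hm hε hmeas (C := 1) fun x => (Circle.norm_coe _).le]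
  simp_rw [← hchar]
  rw [smoothingSymbol, ← integral_subordinator_mul_exp hm hε (sq_nonneg _),
    ← integral_complex_ofReal]
  refine setIntegral_congr_fun measurableSet_Ioi fun s hs => ?_
  simp only [fourier_heatKernel hs, Complex.ofReal_mul]

/-! ### The smoothing operator as a convolution -/

theorem memLp_two_of_integrable_of_bounded {f : Space → ℂ} (hf : Integrable f) {C : ℝ}
    (hC : ∀ x, ‖f x‖ ≤ C) : MemLp f 2 volume := by
  rw [memLp_two_iff_integrable_sq_norm hf.aestronglyMeasurable]
  simp_rw [sq]
  exact hf.norm.mul_bdd hf.norm.aestronglyMeasurable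
    (ae_of_all _ fun x => by rw [norm_norm]; exact hC x)

/-- On `L¹ ∩ L²` the Fourier transform of `L²` is given by the Fourier integral. -/
theorem fourier_toLp_ae_eq {f : Space → ℂ} (hf : Integrable f) (hf2 : MemLp f 2 volume) :
    (𝓕 (hf2.toLp f) : Lp (α := Space) ℂ 2 volume) =ᵐ[volume] 𝓕 f := by
  have hcont : Continuous (𝓕 f) :=
    VectorFourier.fourierIntegral_continuous (μ := volume) Real.continuous_fourierChar
      (by exact continuous_inner) hf
  refine ae_eq_of_integral_contDiff_smul_eq
    ((Lp.memLp (𝓕 (hf2.toLp f) : Lp (α := Space) ℂ 2 volume)).locallyIntegrable (by norm_num))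
    hcont.locallyIntegrable fun g hg hgc => ?_
  -- `g` as a complex-valued Schwartz function
  have hg₁ : HasCompactSupport (Complex.ofRealCLM ∘ g) := hgc.comp_left rfl
  have hg₂ : ContDiff ℝ ((⊤ : ℕ∞) : WithTop ℕ∞) (Complex.ofRealCLM ∘ g) :=
    Complex.ofRealCLM.contDiff.comp hg
  let G := hg₁.toSchwartzMap hg₂
  have happ : ∀ x, G x = (g x : ℂ) := fun x => rfl
  have h := DFunLike.congr_fun (Lp.fourier_toTemperedDistribution_eq (hf2.toLp f)) G
  rw [TemperedDistribution.fourier_apply, Lp.toTemperedDistribution_apply,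
    Lp.toTemperedDistribution_apply] at h
  have hL : ∫ x, g x • (𝓕 (hf2.toLp f) : Lp (α := Space) ℂ 2 volume) x
      = ∫ x, G x • (𝓕 (hf2.toLp f) : Lp (α := Space) ℂ 2 volume) x := by
    simp_rw [happ]
    rfl
  have hR : ∫ x, g x • 𝓕 f x = ∫ x, G x • 𝓕 f x := by
    simp_rw [happ]
    rfl
  have hflip : ∫ x, 𝓕 (G : Space → ℂ) x • f x = ∫ x, G x • 𝓕 f x := by
    have := VectorFourier.integral_fourierIntegral_smul_eq_flip (L := innerₗ Space)
      Real.continuous_fourierChar (by exact continuous_inner) G.integrable hf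
      (μ := volume) (ν := volume)
    rwa [flip_innerₗ] at this
  rw [hL, hR, ← hflip, ← h]
  refine integral_congr_ae ?_
  filter_upwards [hf2.coeFn_toLp] with x hx
  rw [hx, SchwartzMap.fourier_coe]

/-- The convolution of the Bessel kernel with `f`. -/
def besselConv (m ε : ℝ) (f : Space → ℂ) (x : Space) : ℂ :=
  ∫ y, (besselKernel m ε y : ℂ) * f (x - y)

theorem besselConv_eq_convolution (m ε : ℝ) (f : Space → ℂ) :
    besselConv m ε f = convolution (fun x => (besselKernel m ε x : ℂ)) f
      (ContinuousLinearMap.mul ℂ ℂ) volume := rfl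

theorem norm_besselConv_le {m ε : ℝ} (hm : 0 < m) (hε : 0 < ε) {f : Space → ℂ} {C : ℝ}
    (hC : ∀ x, ‖f x‖ ≤ C) (x : Space) :
    ‖besselConv m ε f x‖ ≤ ∫ y, ‖besselKernel m ε y‖ * C := by
  refine norm_integral_le_of_norm_le ((integrable_besselKernel hm hε).norm.mul_const C)
    (ae_of_all _ fun y => ?_)
  rw [norm_mul, Complex.norm_real]
  exact mul_le_mul_of_nonneg_left (hC _) (norm_nonneg _)

/-- On bounded integrable functions `(-Δ + m²)^{-ε}` is the convolution with the Bessel kernel. -/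
theorem smoothing_toLp_ae_eq {m ε : ℝ} (hm : 0 < m) (hε : 0 < ε) {f : Space → ℂ}
    (hf : Integrable f) {C : ℝ} (hC : ∀ x, ‖f x‖ ≤ C) (hf2 : MemLp f 2 volume) :
    smoothing m ε hm hε.le (hf2.toLp f) =ᵐ[volume] besselConv m ε f := by
  have hK : Integrable fun x => (besselKernel m ε x : ℂ) := (integrable_besselKernel hm hε).ofReal
  have hu : Integrable (besselConv m ε f) :=
    hK.integrable_convolution (ContinuousLinearMap.mul ℂ ℂ) hf
  have hu2 := memLp_two_of_integrable_of_bounded hu (norm_besselConv_le hm hε hC)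
  have hF : (memLp_smoothingSymbol_smul hm hε.le (𝓕 (hf2.toLp f))).toLp = 𝓕 (hu2.toLp _) := by
    refine Lp.ext ?_
    filter_upwards [(memLp_smoothingSymbol_smul hm hε.le (𝓕 (hf2.toLp f))).coeFn_toLp,
      fourier_toLp_ae_eq hf hf2, fourier_toLp_ae_eq hu hu2] with k h1 h2 h3
    rw [h1, h2, h3, besselConv_eq_convolution, Real.fourier_mul_convolution_eq hK hf,
      fourier_besselKernel hm hε]
  rw [smoothing, hF, FourierTransform.fourierInv_fourier_eq]
  exact hu2.coeFn_toLp

/-- Although `f` may be discontinuous, its convolution with the integrable Bessel kernel is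
continuous at the origin: for almost every `y` the point `-y` is a continuity point of `f`. -/
theorem tendsto_besselConv {m ε : ℝ} (hm : 0 < m) (hε : 0 < ε) {f : Space → ℂ}
    (hf : Measurable f) {C : ℝ} (hC : ∀ x, ‖f x‖ ≤ C) (hcont : ∀ᵐ x, ContinuousAt f x) :
    Tendsto (besselConv m ε f) (𝓝 0) (𝓝 (∫ y, (besselKernel m ε y : ℂ) * f (-y))) := by
  have hK := integrable_besselKernel hm hε
  refine tendsto_integral_filter_of_dominated_convergence (fun y => ‖besselKernel m ε y‖ * C)
    ?_ ?_ (hK.norm.mul_const C) ?_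
  · exact Eventually.of_forall fun x => hK.ofReal.aestronglyMeasurable.mul
      (hf.comp (measurable_const.sub measurable_id)).aestronglyMeasurable
  · refine Eventually.of_forall fun x => ae_of_all _ fun y => ?_
    rw [norm_mul, Complex.norm_real]
    exact mul_le_mul_of_nonneg_left (hC _) (norm_nonneg _)
  · have hneg : ∀ᵐ y : Space, ContinuousAt f (-y) :=
      (Measure.measurePreserving_neg volume).quasiMeasurePreserving.ae hcont
    filter_upwards [hneg] with y hy
    refine tendsto_const_nhds.mul (hy.tendsto.comp ?_)
    have hc : Continuous fun x : Space => x - y := by fun_prop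
    simpa using hc.tendsto 0

theorem essTendstoAtZero_smoothing {m ε : ℝ} (hm : 0 < m) (hε : 0 < ε) {f : Space → ℂ}
    (hf : Measurable f) (hfi : Integrable f) {C : ℝ} (hC : ∀ x, ‖f x‖ ≤ C)
    (hcont : ∀ᵐ x, ContinuousAt f x) (hf2 : MemLp f 2 volume) :
    EssTendstoAtZero (smoothing m ε hm hε.le (hf2.toLp f))
      (∫ y, (besselKernel m ε y : ℂ) * f (-y)) := by
  refine ((tendsto_besselConv hm hε hf hC hcont).mono_left inf_le_left).congr' ?_
  exact EventuallyEq.filter_mono (smoothing_toLp_ae_eq hm hε hfi hC hf2).symm inf_le_right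

/-! ### The value of the limit -/

theorem besselJ_one_div_eq {m s : ℝ} (hs : s ≠ 0) :
    besselJ 1 (m * s) / s = m * besselQuotient (m ^ 2 * s ^ 2) := by
  rw [besselJ_one_eq, mul_pow]
  field_simp

theorem continuous_mul_besselQuotient (m : ℝ) :
    Continuous fun s : ℝ => m * besselQuotient (m ^ 2 * s ^ 2) := by
  have h := continuous_besselQuotient
  fun_prop

theorem integral_besselJ_one_div (m t : ℝ) :
    ∫ s in (0 : ℝ)..t, besselJ 1 (m * s) / s
      = ∫ s in (0 : ℝ)..t, m * besselQuotient (m ^ 2 * s ^ 2) := by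
  have hne : ∀ᵐ s : ℝ, s ≠ 0 := by simp [ae_iff, measure_singleton]
  refine intervalIntegral.integral_congr_ae ?_
  filter_upwards [hne] with s hs _
  exact besselJ_one_div_eq hs

theorem intervalIntegrable_besselJ_one_div (m t : ℝ) :
    IntervalIntegrable (fun s : ℝ => besselJ 1 (m * s) / s) volume 0 t := by
  have hne : ∀ᵐ s : ℝ, s ≠ 0 := by simp [ae_iff, measure_singleton]
  refine ((continuous_mul_besselQuotient m).intervalIntegrable 0 t).congr_ae ?_
  filter_upwards [ae_restrict_of_ae hne] with s hs
  exact (besselJ_one_div_eq hs).symm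

/-- The common value of the limits. -/
def limitValue (m t : ℝ) : ℝ :=
  -(m / (4 * Real.pi)) + m / (4 * Real.pi) * ∫ s in (0 : ℝ)..t, besselJ 1 (m * s) / s

theorem continuous_limitValue (m : ℝ) : Continuous (limitValue m) := by
  unfold limitValue
  simp_rw [integral_besselJ_one_div]
  have h := intervalIntegral.continuous_primitive (μ := volume)
    (fun a b => (continuous_mul_besselQuotient m).intervalIntegrable a b) 0
  fun_prop

theorem tendsto_green_sub_limitValue (m t : ℝ) (ht : 0 < t) :
    Tendsto (fun x : Space => green m x - kleinGordonGamma m x t) (𝓝[≠] 0)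
      (𝓝 (limitValue m t)) := by
  rw [limitValue, integral_besselJ_one_div, ← lightConeIntegral_zero m t ht]
  exact tendsto_green_sub_kleinGordonGamma m t ht

theorem tendsto_greenDiff_neg (m t : ℝ) (ht : 0 < t) :
    Tendsto (fun y : Space => greenDiff m t (-y)) (𝓝[≠] 0) (𝓝 (limitValue m t : ℂ)) := by
  have h := (Complex.continuous_ofReal.tendsto _).comp (tendsto_green_sub_limitValue m t ht)
  refine h.congr fun x => ?_
  simp [greenDiff, green, kleinGordonGamma]

end DiracPoint

end

theorem lemma3p2 (m : ℝ) (hm : 0 < m) :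
    ∃ μ : ℝ → ℝ,
      (∀ t : ℝ, 0 < t →
        -- `g - γ(·,t)` belongs to `L²`, the inner limits `ν ε` exist for every `ε > 0`,
        -- and they converge to `μ t` as `ε → 0+`
        (∃ hψ : MemLp (fun x : DiracPoint.Space =>
            ((DiracPoint.green m x - DiracPoint.kleinGordonGamma m x t : ℝ) : ℂ)) 2 volume,
          ∃ ν : ℝ → ℂ,
            (∀ (ε : ℝ) (hε : 0 < ε),
              DiracPoint.EssTendstoAtZero
                (DiracPoint.smoothing m ε hm hε.le (hψ.toLp)) (ν ε)) ∧
            Tendsto ν (𝓝[>] 0) (𝓝 (μ t : ℂ))) ∧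
        -- the plain limit exists and equals `μ t`
        Tendsto (fun x : DiracPoint.Space =>
            DiracPoint.green m x - DiracPoint.kleinGordonGamma m x t) (𝓝[≠] 0) (𝓝 (μ t)) ∧
        -- the value
        IntervalIntegrable (fun s : ℝ => DiracPoint.besselJ 1 (m * s) / s) volume 0 t ∧
        μ t = -(m / (4 * Real.pi))
          + m / (4 * Real.pi) * ∫ s in (0 : ℝ)..t, DiracPoint.besselJ 1 (m * s) / s) ∧
      ContinuousOn μ (Set.Ioi 0) ∧
      Tendsto μ (𝓝[>] 0) (𝓝 (-(m / (4 * Real.pi)))) := by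
  refine ⟨DiracPoint.limitValue m, fun t ht => ⟨?_, DiracPoint.tendsto_green_sub_limitValue m t ht,
    DiracPoint.intervalIntegrable_besselJ_one_div m t, rfl⟩,
    (DiracPoint.continuous_limitValue m).continuousOn, ?_⟩
  · have hmeas := DiracPoint.measurable_greenDiff m t ht
    have hint := DiracPoint.integrable_greenDiff m t hm ht
    obtain ⟨C, hC⟩ := DiracPoint.exists_norm_greenDiff_le m t hm ht
    exact ⟨DiracPoint.memLp_two_of_integrable_of_bounded hint hC,
      fun ε => ∫ y, (DiracPoint.besselKernel m ε y : ℂ) * DiracPoint.greenDiff m t (-y),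
      fun ε hε => DiracPoint.essTendstoAtZero_smoothing hm hε hmeas hint hC
        (DiracPoint.ae_continuousAt_greenDiff m t ht) _,
      DiracPoint.tendsto_integral_besselKernel_mul hm (hmeas.comp measurable_neg)
        (fun y => hC (-y)) (DiracPoint.tendsto_greenDiff_neg m t ht)⟩
  · have h := (DiracPoint.continuous_limitValue m).tendsto 0
    have h0 : DiracPoint.limitValue m 0 = -(m / (4 * Real.pi)) := by
      simp [DiracPoint.limitValue]
    rw [h0] at h
    exact h.mono_left nhdsWithin_le_nhds
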